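/- Let $n\ge 1$ and $l\ge 0$ be integers, let $V$ be an $(n+l)$-dimensional vector space over the finite field $\mathbb F_q$, and let $W_1\subseteq V$ be a fixed $l$-dimensional subspace. A subspace $P\subseteq V$ is of type $(m,k)$ if $\dim P=m$ and $\dim(P\cap W_1)=k$. For integers $m_1,k_1,m_2,k_2\ge 0$, let $N(m_1,k_1;m_2,k_2;n+l,n)$ be the number of subspaces of type $(m_1,k_1)$ contained in a given subspace of type $(m_2,k_2)$ of $V$ (this number does not depend on the given subspace; it is taken to be $0$ if $V$ has no subspace of type $(m_2,k_2)$). Two subspaces $A,B$ of $V$ intersect if $\dim(A\cap B)\ge 1$; a family of subspaces is intersecting if any two of its members intersect. The covering number $\tau(\mathcal F)$ of a family $\mathcal F$ is the minimum dimension of a subspace of $V$ that intersects every member of $\mathcal F$. **Theorem.** Let $m,k\ge 0$ be integers with $q\ge m+2\ge 5$, and let $\mathcal F$ be an intersecting family of subspaces of $V$ of type $(m,k)$ with $\tau(\mathcal F)=m$. Put $t=\max\{0,2m-1-n\}$ if $k=0$ and $t=m+k-1$ if $k\ge 1$. Then $$|\mathcal F|\le N(m,k;2m-1,t;n+l,n),$$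 and equality holds if and only if there is a subspace $X\subseteq V$ of type $(2m-1,t)$ such that $\mathcal F$ is the set of all subspaces of type $(m,k)$ contained in $X$. -/

import Mathlib

namespace SingularLinear

open Module

variable {K V : Type*} [Field K] [AddCommGroup V] [Module K V]

/-- Relative to the fixed subspace `W` of `V`, the subspace `P` is of type `(m, k)` when
`dim P = m` and `dim (P ∩ W) = k`. -/
def IsOfType (W : Submodule K V) (m k : ℕ) (P : Submodule K V) : Prop :=
  finrank K P = m ∧ finrank K (P ⊓ W : Submodule K V) = k

/-- The family of all subspaces of type `(m, k)` contained in `X`. -/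
def subspacesOfType (W : Submodule K V) (m k : ℕ) (X : Submodule K V) :
    Set (Submodule K V) :=
  {P | P ≤ X ∧ IsOfType W m k P}

/-- `A` intersects `B` when `dim (A ∩ B) ≥ 1`. -/
def Intersects (A B : Submodule K V) : Prop :=
  1 ≤ finrank K (A ⊓ B : Submodule K V)

/-- A family of subspaces is intersecting when any two members intersect. -/
def IsIntersecting (F : Set (Submodule K V)) : Prop :=
  ∀ A ∈ F, ∀ B ∈ F, Intersects A B

/-- The covering number: the minimum dimension of a subspace of `V` that intersects all
members of `F`. -/
noncomputable def coveringNumber (F : Set (Submodule K V)) : ℕ :=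
  sInf {d | ∃ S : Submodule K V, finrank K S = d ∧ ∀ A ∈ F, Intersects S A}

open Classical in
/-- The number of subspaces of type `(m₁, k₁)` contained in a given subspace of type `(m, k)`
of `V`. It does not depend on the given subspace, see `numSubspaces_eq`; it is `0` if `V` has no
subspace of type `(m, k)`. -/
noncomputable def numSubspaces (W : Submodule K V) (m₁ k₁ m k : ℕ) : ℕ :=
  if h : ∃ X : Submodule K V, IsOfType W m k X then
    (subspacesOfType W m₁ k₁ h.choose).ncard
  else 0

/-- The parameter `t`: it is `max {0, 2m - 1 - n}` (truncated subtraction of natural numbers) if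
`k = 0`, and `m + k - 1` if `k ≥ 1`. -/
def extremalParam (m k n : ℕ) : ℕ :=
  if k = 0 then 2 * m - 1 - n else m + k - 1

/-- Two subspaces of the same type are related by a linear equivalence that matches their
intersections with `W`. -/
theorem exists_equiv [FiniteDimensional K V] {W X Y : Submodule K V} {m k : ℕ}
    (hX : IsOfType W m k X) (hY : IsOfType W m k Y) :
    ∃ e : X ≃ₗ[K] Y, ∀ x : X, ((e x : V) ∈ W ↔ (x : V) ∈ W) := by
  have key : ∀ Z : Submodule K V, finrank K (W.comap Z.subtype) =
      finrank K (Z ⊓ W : Submodule K V) := by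
    intro Z
    rw [← Submodule.map_comap_subtype]
    exact (Submodule.equivMapOfInjective _ Z.injective_subtype _).finrank_eq
  obtain ⟨C, hC⟩ := Submodule.exists_isCompl (W.comap X.subtype)
  obtain ⟨D, hD⟩ := Submodule.exists_isCompl (W.comap Y.subtype)
  have h1 : finrank K (W.comap X.subtype) = finrank K (W.comap Y.subtype) := by
    rw [key, key, hX.2, hY.2]
  have h2 : finrank K C = finrank K D := by
    have a := Submodule.finrank_add_eq_of_isCompl hC
    have b := Submodule.finrank_add_eq_of_isCompl hD
    have c := hX.1
    have d := hY.1
    omega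
  let e1 := LinearEquiv.ofFinrankEq _ _ h1
  let e2 := LinearEquiv.ofFinrankEq _ _ h2
  refine ⟨(Submodule.prodEquivOfIsCompl _ _ hC).symm ≪≫ₗ (e1.prodCongr e2) ≪≫ₗ
    (Submodule.prodEquivOfIsCompl _ _ hD), fun x => ?_⟩
  obtain ⟨⟨a, b⟩, rfl⟩ := (Submodule.prodEquivOfIsCompl _ _ hC).surjective x
  have ha : ((a : X) : V) ∈ W := a.2
  have he : (((e1 a : Y)) : V) ∈ W := (e1 a).2
  have hb : (((b : X)) : V) ∈ W ↔ b = 0 := by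
    constructor
    · intro h
      have : (b : X) ∈ (W.comap X.subtype) ⊓ C := ⟨h, b.2⟩
      rw [hC.inf_eq_bot] at this
      exact Subtype.ext ((Submodule.mem_bot K).1 this)
    · rintro rfl
      simp
  have hd : (((e2 b : Y)) : V) ∈ W ↔ e2 b = 0 := by
    constructor
    · intro h
      have : ((e2 b : D) : Y) ∈ (W.comap Y.subtype) ⊓ D := ⟨h, (e2 b).2⟩
      rw [hD.inf_eq_bot] at this
      exact Subtype.ext ((Submodule.mem_bot K).1 this)
    · intro h
      simp [h]
  rw [LinearEquiv.trans_apply, LinearEquiv.trans_apply, LinearEquiv.symm_apply_apply,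
    LinearEquiv.prodCongr_apply, Submodule.coe_prodEquivOfIsCompl',
    Submodule.coe_prodEquivOfIsCompl', Submodule.coe_add, Submodule.coe_add]
  rw [Submodule.add_mem_iff_right W he, Submodule.add_mem_iff_right W ha, hb, hd]
  simp

/-- One inequality between the counts in two subspaces of the same type. -/
theorem ncard_le_of_isOfType [Finite K] [FiniteDimensional K V] {W X Y : Submodule K V}
    {m k : ℕ} (hX : IsOfType W m k X) (hY : IsOfType W m k Y) (m₁ k₁ : ℕ) :
    (subspacesOfType W m₁ k₁ X).ncard ≤ (subspacesOfType W m₁ k₁ Y).ncard := by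
  obtain ⟨e, he⟩ := exists_equiv hX hY
  have : Finite V := Module.finite_of_finite K
  have : Finite (Submodule K V) := Finite.of_injective _ SetLike.coe_injective
  let f : X →ₗ[K] V := Y.subtype ∘ₗ e.toLinearMap
  have hf : Function.Injective f := Y.injective_subtype.comp e.injective
  have hcomap : ∀ P ≤ X, (P.comap X.subtype).map X.subtype = P := by
    intro P hP
    rw [Submodule.map_comap_subtype, inf_eq_right.2 hP]
  have hrank : ∀ P ≤ X, finrank K ((P.comap X.subtype).map f) = finrank K P := by
    intro P hP
    rw [← (Submodule.equivMapOfInjective f hf _).finrank_eq,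
      (Submodule.equivMapOfInjective _ X.injective_subtype _).finrank_eq, hcomap P hP]
  refine Set.ncard_le_ncard_of_injOn (fun P => (P.comap X.subtype).map f) ?_ ?_ (Set.toFinite _)
  · rintro P ⟨hP, h1, h2⟩
    refine ⟨?_, ?_, ?_⟩
    · rintro _ ⟨x, -, rfl⟩
      exact (e x).2
    · rw [hrank P hP, h1]
    · rw [← h2, ← hrank (P ⊓ W) (inf_le_left.trans hP)]
      have hset : (P.comap X.subtype).map f ⊓ W = ((P ⊓ W).comap X.subtype).map f := by
        ext v
        constructor
        · rintro ⟨⟨x, hx, rfl⟩, hv⟩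
          exact ⟨x, ⟨hx, (he x).1 hv⟩, rfl⟩
        · rintro ⟨x, ⟨hx, hw⟩, rfl⟩
          exact ⟨⟨x, hx, rfl⟩, (he x).2 hw⟩
      exact congrArg (fun S : Submodule K V => finrank K S) hset
  · rintro P ⟨hP, -⟩ Q ⟨hQ, -⟩ h
    have := Submodule.map_injective_of_injective hf h
    rw [← hcomap P hP, this, hcomap Q hQ]

/-- `numSubspaces` is well defined: it is the count inside any subspace of type `(m, k)`. -/
theorem numSubspaces_eq [Finite K] [FiniteDimensional K V] {W X : Submodule K V} {m k : ℕ}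
    (hX : IsOfType W m k X) (m₁ k₁ : ℕ) :
    numSubspaces W m₁ k₁ m k = (subspacesOfType W m₁ k₁ X).ncard := by
  have h : ∃ X : Submodule K V, IsOfType W m k X := ⟨X, hX⟩
  rw [numSubspaces, dif_pos h]
  exact le_antisymm (ncard_le_of_isOfType h.choose_spec hX m₁ k₁)
    (ncard_le_of_isOfType hX h.choose_spec m₁ k₁)

end SingularLinear

/-!
Let `q = |K|` and `[d] = 1 + q + ⋯ + q ^ (d - 1)`, the number of points of a `d`-dimensional space.
As the covering number is `m`, every subspace `S` of dimension less than `m` misses some member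
`A` of `F`, while the members of `F` above `S` all meet `A`. Distributing them over the `[m]` points
of `A` and iterating shows that at most `[m] ^ (m - s)` members lie above an `s`-dimensional space
(`ncard_above_le`).

The bound improves at the last step (`ncard_above_le_or_exists`). If `dim S = m - 1` and `A` misses
`S`, a member above `S` is spanned by `S` and a point of `A`. Either a second member `B` missing `S`
and not contained in `S ⊔ A` confines this point to a hyperplane of `A`, so that at most `[m - 1]`
members lie above `S`, or every member of `F` meets `S` or lies in `X = S ⊔ A`, a space of
dimension `2 * m - 1`. If the first alternative holds for all `S`, then
`|F| ≤ [m - 1] * [m] ^ (m - 1)`. Otherwise fix an `S` with the second alternative. If some member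
`B` is not contained in `X`, then the members inside `X` meet `B ⊓ X` and those not inside `X` meet
`S`, both of dimension at most `m - 1`, so `|F| ≤ 2 * [m - 1] * [m] ^ (m - 1)`. For `q ≥ m + 2 ≥ 5`
this is less than `q ^ (m * (m - 1))` by Bernoulli's inequality. Hence either
`|F| < q ^ (m * (m - 1))` or `F` lives in a space `X` of dimension `2 * m - 1`
(`ncard_lt_or_exists_forall_le`).

A space of type `(2 * m - 1, t)` contains at least `q ^ (m * (m - 1))` subspaces of type `(m, k)`,
namely the graphs of the linear maps from one of them to a suitable complement
(`exists_extremal_compl`, `pow_le_ncard_subspacesOfType`). This settles the first case with strict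
inequality. In the second case let `s = dim (X ⊓ W)`. If `k ≥ 1`, a subspace of `X ⊓ W` of dimension
`s - k + 1` covers `F`, so `s ≥ m + k - 1` (`coveringNumber_add_le_finrank`), and `s` cannot be
larger because `X` contains a space of type `(m, k)`; thus `s = t`. If `k = 0`, then `s ≥ t`, and for
`s > t` the space `X` has strictly fewer subspaces of type `(m, 0)`
(`ncard_subspacesOfType_zero_lt`). For `s = t` the family consists of subspaces of type `(m, k)` of a
space of type `(2 * m - 1, t)`, which gives the bound and the case of equality.
-/

namespace SingularLinear

open Module

/-! ### Dimensions of subspaces -/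

section Dimension

variable {K V : Type*} [Field K] [AddCommGroup V] [Module K V] [FiniteDimensional K V]

theorem intersects_iff_ne_bot {A B : Submodule K V} : Intersects A B ↔ A ⊓ B ≠ ⊥ := by
  rw [Intersects, Nat.one_le_iff_ne_zero, Ne, Submodule.finrank_eq_zero]

theorem finrank_sup_span_singleton {S : Submodule K V} {v : V} (hv : v ∉ S) :
    finrank K (S ⊔ K ∙ v : Submodule K V) = finrank K S + 1 := by
  have h0 : v ≠ 0 := fun h => hv (h ▸ S.zero_mem)
  have h := Submodule.finrank_sup_add_finrank_inf_eq S (K ∙ v)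
  rw [((Submodule.disjoint_span_singleton_of_notMem hv)).eq_bot, finrank_bot,
    finrank_span_singleton h0] at h
  exact h

/-- Between nested subspaces there are subspaces of every intermediate dimension. -/
theorem exists_between_finrank {A C : Submodule K V} (hAC : A ≤ C) {d : ℕ}
    (h1 : finrank K A ≤ d) (h2 : d ≤ finrank K C) :
    ∃ B : Submodule K V, A ≤ B ∧ B ≤ C ∧ finrank K B = d := by
  induction d, h1 using Nat.le_induction with
  | base => exact ⟨A, le_rfl, hAC, rfl⟩
  | succ d _ ih =>
    obtain ⟨B, hAB, hBC, hB⟩ := ih (by omega)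
    have hlt : B < C := lt_of_le_of_ne hBC (by rintro rfl; omega)
    obtain ⟨v, hvC, hvB⟩ := SetLike.exists_of_lt hlt
    refine ⟨B ⊔ K ∙ v, hAB.trans le_sup_left, sup_le hBC ?_, ?_⟩
    · rwa [Submodule.span_singleton_le_iff_mem]
    · rw [finrank_sup_span_singleton hvB, hB]

theorem finrank_sup_of_inf_eq_bot {A B : Submodule K V} (h : A ⊓ B = ⊥) :
    finrank K (A ⊔ B : Submodule K V) = finrank K A + finrank K B := by
  have := Submodule.finrank_sup_add_finrank_inf_eq A B
  rw [h, finrank_bot] at this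
  exact this

omit [FiniteDimensional K V] in
/-- If `A` and `B` are subspaces of `X` with trivial intersection, then `A` has a complement in `X`
that contains `B`. -/
theorem exists_relative_compl {A B X : Submodule K V} (hA : A ≤ X) (hB : B ≤ X)
    (h : A ⊓ B = ⊥) : ∃ C : Submodule K V, B ≤ C ∧ C ≤ X ∧ A ⊓ C = ⊥ ∧ A ⊔ C = X := by
  obtain ⟨C, hBC, hC⟩ := (disjoint_iff.2 h).symm.exists_isCompl
  refine ⟨C ⊓ X, le_inf hBC hB, inf_le_right, ?_, ?_⟩
  · rw [← inf_assoc, inf_comm A, hC.inf_eq_bot, bot_inf_eq]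
  · rw [← sup_inf_assoc_of_le C hA, sup_comm, hC.sup_eq_top, top_inf_eq]

theorem exists_linearEquiv_map_eq {V₁ V₂ : Type*} [AddCommGroup V₁] [Module K V₁]
    [AddCommGroup V₂] [Module K V₂] [FiniteDimensional K V₁] [FiniteDimensional K V₂]
    (h : finrank K V₁ = finrank K V₂) (A : Submodule K V₁) (B : Submodule K V₂)
    (hAB : finrank K A = finrank K B) :
    ∃ e : V₁ ≃ₗ[K] V₂, A.map (e : V₁ →ₗ[K] V₂) = B := by
  let e : V₁ ≃ₗ[K] V₂ := LinearEquiv.ofFinrankEq _ _ h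
  let f : A.map (e : V₁ →ₗ[K] V₂) ≃ₗ[K] B :=
    LinearEquiv.ofFinrankEq _ _ (by rw [LinearEquiv.finrank_map_eq, hAB])
  obtain ⟨g, hg⟩ := Submodule.exists_linearEquiv_restrict_eq f
  refine ⟨e ≪≫ₗ g, le_antisymm ?_ fun y hy => ?_⟩
  · rintro _ ⟨x, hx, rfl⟩
    have := hg ⟨e x, x, hx, rfl⟩
    rw [LinearEquiv.coe_coe, LinearEquiv.trans_apply, ← this]
    exact (f _).2
  · obtain ⟨⟨_, x, hx, rfl⟩, hz⟩ := f.surjective ⟨y, hy⟩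
    refine ⟨x, hx, ?_⟩
    rw [LinearEquiv.coe_coe, LinearEquiv.trans_apply]
    exact (hg _).symm.trans (congrArg Subtype.val hz)

end Dimension

/-! ### Counting points -/

section Count

/-- The number `1 + q + ⋯ + q ^ (d - 1)` of one-dimensional subspaces of a `d`-dimensional space
over a field with `q` elements. -/
def pointCount (q d : ℕ) : ℕ := ∑ i ∈ Finset.range d, q ^ i

theorem pointCount_mono (q : ℕ) : Monotone (pointCount q) := fun _ _ h =>
  Finset.sum_le_sum_of_subset (Finset.range_mono h)

theorem pointCount_mul_lt {q : ℕ} (hq : 0 < q) (d : ℕ) :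
    pointCount q d * (q - 1) < q ^ d := by
  obtain ⟨r, rfl⟩ : ∃ r, q = r + 1 := ⟨q - 1, by omega⟩
  have := geom_sum_mul_add r d
  simp only [pointCount, Nat.add_sub_cancel]
  omega

/-- A form of Bernoulli's inequality. -/
theorem succ_pow_succ_le (a j : ℕ) :
    (a + 1) ^ (j + 1) ≤ a ^ j * (a + 1) + j * (a + 1) ^ j := by
  induction j with
  | zero => simp
  | succ j ih =>
    have h : a ^ j ≤ (a + 1) ^ j := Nat.pow_le_pow_left (by omega) j
    have h2 := Nat.mul_le_mul_left a ih
    ring_nf at *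
    nlinarith

/-- The hypothesis `m + 2 ≤ q` enters the counting argument through this estimate. -/
theorem two_mul_pow_le {q m : ℕ} (hm : 3 ≤ m) (hq : m + 2 ≤ q) :
    2 * q ^ (m - 1) ≤ (q - 1) ^ m := by
  obtain ⟨j, rfl⟩ : ∃ j, m = j + 1 := ⟨m - 1, by omega⟩
  obtain ⟨a, rfl⟩ : ∃ a, q = a + 1 := ⟨q - 1, by omega⟩
  simp only [Nat.add_sub_cancel]
  have hB := succ_pow_succ_le a j
  have h3 : 3 * (a + 1) ^ j ≤ a ^ j * (a + 1) := by
    have : (j + 3) * (a + 1) ^ j ≤ (a + 1) ^ (j + 1) := by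
      rw [pow_succ, mul_comm]
      exact Nat.mul_le_mul_left _ (by omega)
    rw [add_mul] at this
    omega
  -- `2 * (a + 1) ≤ 3 * a` as `a ≥ 2`.
  refine Nat.le_of_mul_le_mul_right (c := a + 1) ?_ (by omega)
  calc 2 * (a + 1) ^ j * (a + 1) = (2 * (a + 1)) * (a + 1) ^ j := by ring
    _ ≤ (3 * a) * (a + 1) ^ j := Nat.mul_le_mul_right _ (by omega)
    _ = a * (3 * (a + 1) ^ j) := by ring
    _ ≤ a * (a ^ j * (a + 1)) := Nat.mul_le_mul_left _ h3
    _ = a ^ (j + 1) * (a + 1) := by ring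

theorem two_mul_pointCount_mul_lt {q m : ℕ} (hm : 3 ≤ m) (hq : m + 2 ≤ q) :
    2 * (pointCount q (m - 1) * pointCount q m ^ (m - 1)) < q ^ (m * (m - 1)) := by
  have h1 := pointCount_mul_lt (q := q) (by omega) (m - 1)
  have h2 := pointCount_mul_lt (q := q) (by omega) m
  refine lt_of_mul_lt_mul_right (a := (q - 1) ^ m) ?_ (Nat.zero_le _)
  calc 2 * (pointCount q (m - 1) * pointCount q m ^ (m - 1)) * (q - 1) ^ m
      = 2 * (pointCount q (m - 1) * (q - 1)) * (pointCount q m * (q - 1)) ^ (m - 1) := by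
        rw [← mul_pow_sub_one (by omega : m ≠ 0) (q - 1), mul_pow]
        ring
    _ ≤ 2 * (pointCount q (m - 1) * (q - 1)) * (q ^ m) ^ (m - 1) := by gcongr
    _ < 2 * q ^ (m - 1) * (q ^ m) ^ (m - 1) := by
        have hq0 : 0 < q := by omega
        have : 0 < (q ^ m) ^ (m - 1) := by positivity
        gcongr
    _ ≤ (q - 1) ^ m * (q ^ m) ^ (m - 1) := Nat.mul_le_mul_right _ (two_mul_pow_le hm hq)
    _ = q ^ (m * (m - 1)) * (q - 1) ^ m := by rw [← pow_mul, mul_comm]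

variable {K V : Type*} [Field K] [Finite K] [AddCommGroup V] [Module K V]
  [FiniteDimensional K V]

theorem finite_set_submodule (G : Set (Submodule K V)) : G.Finite := by
  have : Finite V := Module.finite_of_finite K
  have : Finite (Submodule K V) := Finite.of_injective _ SetLike.coe_injective
  exact Set.toFinite G

/-- If all members of `G` meet `D`, then they are distributed over the points of `D`. -/
theorem ncard_le_pointCount_mul {G : Set (Submodule K V)} {D : Submodule K V} {M : ℕ}
    (hD : ∀ P ∈ G, D ⊓ P ≠ ⊥)
    (hM : ∀ v ∈ D, v ≠ 0 → {P ∈ G | v ∈ P}.ncard ≤ M) :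
    G.ncard ≤ pointCount (Nat.card K) (finrank K D) * M := by
  have : Finite V := Module.finite_of_finite K
  have : Fintype (Projectivization K D) := Fintype.ofFinite _
  have hsub : G ⊆ ⋃ x : Projectivization K D, {P ∈ G | (x.rep : V) ∈ P} := by
    intro P hP
    obtain ⟨v, ⟨hvD, hvP⟩, hv0⟩ := Submodule.exists_mem_ne_zero_of_ne_bot (hD P hP)
    have hv : (⟨v, hvD⟩ : D) ≠ 0 := fun h => hv0 (congrArg Subtype.val h)
    obtain ⟨a, ha⟩ := Projectivization.exists_smul_eq_mk_rep K (⟨v, hvD⟩ : D) hv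
    refine Set.mem_iUnion.2 ⟨Projectivization.mk K _ hv, hP, ?_⟩
    rw [← ha]
    exact P.smul_mem (a : K) hvP
  calc G.ncard ≤ (⋃ x : Projectivization K D, {P ∈ G | (x.rep : V) ∈ P}).ncard :=
        Set.ncard_le_ncard hsub (finite_set_submodule _)
    _ ≤ ∑ x : Projectivization K D, {P ∈ G | (x.rep : V) ∈ P}.ncard :=
        Set.ncard_iUnion_le_of_fintype _
    _ ≤ ∑ _x : Projectivization K D, M := Finset.sum_le_sum fun x _ =>
        hM _ x.rep.2 fun h => x.rep_nonzero (Subtype.ext h)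
    _ = pointCount (Nat.card K) (finrank K D) * M := by
        rw [Finset.sum_const, Finset.card_univ, smul_eq_mul, ← Nat.card_eq_fintype_card,
          Projectivization.card_of_finrank K D rfl, pointCount]

end Count

/-! ### Intersecting families with large covering number -/

section Family

variable {K V : Type*} [Field K] [AddCommGroup V] [Module K V] [FiniteDimensional K V]

/-- A subspace of dimension smaller than the covering number misses some member of the family. -/
theorem exists_inf_eq_bot_of_lt_coveringNumber {F : Set (Submodule K V)} {S : Submodule K V}
    (hS : finrank K S < coveringNumber F) : ∃ A ∈ F, S ⊓ A = ⊥ := by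
  by_contra! h
  exact Nat.notMem_of_lt_sInf hS ⟨S, rfl, fun A hA => intersects_iff_ne_bot.2 (h A hA)⟩

/-- If every member of `F` meets `Y` in dimension at least `k ≥ 1`, then a subspace of `Y` of
codimension `k - 1` covers `F`, so `Y` is large. -/
theorem coveringNumber_add_le_finrank {F : Set (Submodule K V)} {Y : Submodule K V} {k : ℕ}
    (hk : 1 ≤ k) (hF : F.Nonempty) (h : ∀ P ∈ F, k ≤ finrank K (P ⊓ Y : Submodule K V)) :
    coveringNumber F + k - 1 ≤ finrank K Y := by
  obtain ⟨P₀, hP₀⟩ := hF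
  have hkY : k ≤ finrank K Y := (h P₀ hP₀).trans (Submodule.finrank_mono inf_le_right)
  obtain ⟨S, -, hSY, hS⟩ := exists_between_finrank (bot_le : ⊥ ≤ Y)
    (d := finrank K Y + 1 - k) (by simp) (by omega)
  by_contra! hlt
  obtain ⟨A, hA, hSA⟩ := exists_inf_eq_bot_of_lt_coveringNumber (F := F) (S := S) (by omega)
  have h1 : S ⊓ (A ⊓ Y) = ⊥ := by rw [← inf_assoc, hSA, bot_inf_eq]
  have h2 := finrank_sup_of_inf_eq_bot h1
  have h3 := Submodule.finrank_mono (sup_le hSY inf_le_right : S ⊔ A ⊓ Y ≤ Y)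
  have h4 := h A hA
  omega

variable [Finite K]

/-- Climbing from dimension `finrank K S` to dimension `r`: as long as `S` is not a cover, the
members above `S` are distributed over the points of a member of `F` that misses `S`. -/
theorem ncard_above_le {F : Set (Submodule K V)} {m r b : ℕ} (hr : r ≤ m)
    (hdim : ∀ P ∈ F, finrank K P = m) (hint : IsIntersecting F) (hcov : coveringNumber F = m)
    (hb : ∀ S : Submodule K V, finrank K S = r → {P ∈ F | S ≤ P}.ncard ≤ b)
    (S : Submodule K V) (hS : finrank K S ≤ r) :
    {P ∈ F | S ≤ P}.ncard ≤ pointCount (Nat.card K) m ^ (r - finrank K S) * b := by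
  obtain ⟨j, hj⟩ : ∃ j, r - finrank K S = j := ⟨_, rfl⟩
  rw [hj]
  induction j generalizing S with
  | zero => simpa using hb S (by omega)
  | succ j ih =>
    obtain ⟨A, hA, hSA⟩ := exists_inf_eq_bot_of_lt_coveringNumber (F := F) (S := S) (by omega)
    rw [pow_succ', mul_assoc, ← hdim A hA]
    refine ncard_le_pointCount_mul
      (fun P hP => intersects_iff_ne_bot.1 (hint A hA P hP.1)) fun v hv hv0 => ?_
    have hvS : v ∉ S := fun h => hv0 (by
      have : v ∈ S ⊓ A := ⟨h, hv⟩
      rwa [hSA, Submodule.mem_bot] at this)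
    have hfin := finrank_sup_span_singleton hvS
    refine le_trans (Set.ncard_le_ncard ?_ (finite_set_submodule _))
      ((ih (S ⊔ K ∙ v) (by omega) (by omega)).trans_eq (by rw [hdim A hA]))
    rintro P ⟨⟨hPF, hSP⟩, hvP⟩
    exact ⟨hPF, sup_le hSP ((Submodule.span_singleton_le_iff_mem v P).2 hvP)⟩

theorem ncard_above_le_one {F : Set (Submodule K V)} {m : ℕ}
    (hdim : ∀ P ∈ F, finrank K P = m) (S : Submodule K V) (hS : finrank K S = m) :
    {P ∈ F | S ≤ P}.ncard ≤ 1 := by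
  have h : ∀ P ∈ {P ∈ F | S ≤ P}, P = S := fun P hP =>
    (Submodule.eq_of_le_of_finrank_eq hP.2 (by rw [hS, hdim P hP.1])).symm
  exact (Set.ncard_le_one (finite_set_submodule _)).2 fun P hP Q hQ => by rw [h P hP, h Q hQ]

/-- At most `pointCount q m ^ (m - 1)` members pass through a given point, hence this bound for
the members that meet `D`. -/
theorem ncard_le_of_meets {F G : Set (Submodule K V)} {m : ℕ} (hm : 1 ≤ m) (hGF : G ⊆ F)
    (hdim : ∀ P ∈ F, finrank K P = m) (hint : IsIntersecting F) (hcov : coveringNumber F = m)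
    {D : Submodule K V} (hD : ∀ P ∈ G, D ⊓ P ≠ ⊥) :
    G.ncard ≤ pointCount (Nat.card K) (finrank K D) * pointCount (Nat.card K) m ^ (m - 1) := by
  refine ncard_le_pointCount_mul hD fun v hv hv0 => ?_
  have h1 : finrank K (K ∙ v) = 1 := finrank_span_singleton hv0
  have h := ncard_above_le le_rfl hdim hint hcov (ncard_above_le_one hdim) (K ∙ v) (by omega)
  rw [h1, mul_one] at h
  refine le_trans (Set.ncard_le_ncard ?_ (finite_set_submodule _)) h
  rintro P ⟨hP, hvP⟩
  exact ⟨hGF hP, (Submodule.span_singleton_le_iff_mem v P).2 hvP⟩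

/-- Let `S` have dimension `m - 1`. A member of `F` above `S` is `S ⊔ K ∙ a` for a point `a` of a
fixed member `A` that misses `S`. If a further member `B` misses `S` and is not contained in
`S ⊔ A`, then the point has to lie in the proper subspace `A ⊓ (S ⊔ B)` of `A`. -/
theorem ncard_above_le_or_exists {F : Set (Submodule K V)} {m : ℕ} (hm : 1 ≤ m)
    (hdim : ∀ P ∈ F, finrank K P = m) (hint : IsIntersecting F) (hcov : coveringNumber F = m)
    (S : Submodule K V) (hS : finrank K S = m - 1) :
    {P ∈ F | S ≤ P}.ncard ≤ pointCount (Nat.card K) (m - 1) ∨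
      ∃ X : Submodule K V, finrank K X = 2 * m - 1 ∧ ∀ B ∈ F, S ⊓ B ≠ ⊥ ∨ B ≤ X := by
  obtain ⟨A, hA, hSA⟩ := exists_inf_eq_bot_of_lt_coveringNumber (F := F) (S := S) (by omega)
  have hSAdim := finrank_sup_of_inf_eq_bot hSA
  rw [hS, hdim A hA] at hSAdim
  refine or_iff_not_imp_right.2 fun hX => ?_
  push Not at hX
  obtain ⟨B, hB, hSB, hBX⟩ := hX (S ⊔ A) (by omega)
  have hSBdim := finrank_sup_of_inf_eq_bot hSB
  rw [hS, hdim B hB] at hSBdim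
  have hlt : A ⊓ (S ⊔ B) < A := by
    refine lt_of_le_of_ne inf_le_left fun h => hBX ?_
    have hle : S ⊔ A ≤ S ⊔ B := sup_le le_sup_left (inf_eq_left.1 h)
    rw [Submodule.eq_of_le_of_finrank_eq hle (by omega)]
    exact le_sup_right
  have hltdim := Submodule.finrank_lt_finrank_of_lt hlt
  rw [hdim A hA] at hltdim
  -- A member above `S` is spanned by `S` and any of its points on a member that misses `S`.
  have key : ∀ P ∈ {P ∈ F | S ≤ P}, ∀ C ∈ F, S ⊓ C = ⊥ →
      ∃ v ∈ C, v ≠ 0 ∧ v ∈ P ∧ S ⊔ K ∙ v = P := by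
    rintro P ⟨hP, hSP⟩ C hC hSC
    obtain ⟨v, ⟨hvC, hvP⟩, hv0⟩ := Submodule.exists_mem_ne_zero_of_ne_bot
      (intersects_iff_ne_bot.1 (hint C hC P hP))
    have hvS : v ∉ S := fun h => hv0 (by
      have : v ∈ S ⊓ C := ⟨h, hvC⟩
      rwa [hSC, Submodule.mem_bot] at this)
    refine ⟨v, hvC, hv0, hvP, Submodule.eq_of_le_of_finrank_eq
      (sup_le hSP ((Submodule.span_singleton_le_iff_mem v P).2 hvP)) ?_⟩
    rw [finrank_sup_span_singleton hvS, hdim P hP]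
    omega
  have hle := ncard_le_pointCount_mul (G := {P ∈ F | S ≤ P}) (D := A ⊓ (S ⊔ B)) (M := 1) ?_ ?_
  · rw [mul_one] at hle
    exact hle.trans (pointCount_mono _ (by omega))
  · intro P hP
    obtain ⟨a, haA, ha0, haP, -⟩ := key P hP A hA hSA
    obtain ⟨b, hbB, -, -, hbP⟩ := key P hP B hB hSB
    refine (Submodule.ne_bot_iff _).2 ⟨a, ⟨⟨haA, ?_⟩, haP⟩, ha0⟩
    rw [← hbP] at haP
    exact sup_le_sup_left ((Submodule.span_singleton_le_iff_mem b B).2 hbB) S haP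
  · intro v hv hv0
    have hvS : v ∉ S := fun h => hv0 (by
      have : v ∈ S ⊓ A := ⟨h, hv.1⟩
      rwa [hSA, Submodule.mem_bot] at this)
    refine le_trans (Set.ncard_le_ncard ?_ (finite_set_submodule _))
      (ncard_above_le_one hdim (S ⊔ K ∙ v) (by
        rw [finrank_sup_span_singleton hvS]
        omega))
    rintro P ⟨⟨hPF, hSP⟩, hvP⟩
    exact ⟨hPF, sup_le hSP ((Submodule.span_singleton_le_iff_mem v P).2 hvP)⟩

/-- A family that is not contained in a subspace of dimension `2 * m - 1` is small. -/
theorem ncard_lt_or_exists_forall_le {F : Set (Submodule K V)} {m : ℕ} (hm : 3 ≤ m)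
    (hq : m + 2 ≤ Nat.card K) (hdim : ∀ P ∈ F, finrank K P = m) (hint : IsIntersecting F)
    (hcov : coveringNumber F = m) :
    F.ncard < Nat.card K ^ (m * (m - 1)) ∨
      ∃ X : Submodule K V, finrank K X = 2 * m - 1 ∧ ∀ P ∈ F, P ≤ X := by
  have hnum := two_mul_pointCount_mul_lt hm hq
  by_cases hS : ∃ S : Submodule K V, finrank K S = m - 1 ∧
      ∃ X : Submodule K V, finrank K X = 2 * m - 1 ∧ ∀ B ∈ F, S ⊓ B ≠ ⊥ ∨ B ≤ X
  · obtain ⟨S, hS, X, hX, hSX⟩ := hS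
    refine or_iff_not_imp_right.2 fun hFX => ?_
    push Not at hFX
    obtain ⟨B, hB, hBX⟩ := hFX X hX
    have hlt : B ⊓ X < B := lt_of_le_of_ne inf_le_left fun h => hBX (inf_eq_left.1 h)
    have hltdim := Submodule.finrank_lt_finrank_of_lt hlt
    rw [hdim B hB] at hltdim
    have h1 := ncard_le_of_meets (G := {P ∈ F | P ≤ X}) (D := B ⊓ X) (by omega)
      (Set.sep_subset _ _) hdim hint hcov fun P hP => by
        rw [inf_assoc, inf_eq_right.2 hP.2]
        exact intersects_iff_ne_bot.1 (hint B hB P hP.1)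
    have h2 := ncard_le_of_meets (G := {P ∈ F | ¬ P ≤ X}) (D := S) (by omega)
      (Set.sep_subset _ _) hdim hint hcov fun P hP => (hSX P hP.1).resolve_right hP.2
    rw [hS] at h2
    have h3 : F.ncard ≤ {P ∈ F | P ≤ X}.ncard + {P ∈ F | ¬ P ≤ X}.ncard := by
      refine le_trans (Set.ncard_le_ncard ?_ (finite_set_submodule _)) (Set.ncard_union_le _ _)
      intro P hP
      by_cases h : P ≤ X
      · exact Or.inl ⟨hP, h⟩
      · exact Or.inr ⟨hP, h⟩
    have h4 : pointCount (Nat.card K) (finrank K (B ⊓ X : Submodule K V)) *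
        pointCount (Nat.card K) m ^ (m - 1) ≤
        pointCount (Nat.card K) (m - 1) * pointCount (Nat.card K) m ^ (m - 1) :=
      Nat.mul_le_mul_right _ (pointCount_mono _ (by omega))
    omega
  · left
    have hb := fun S hS' => (ncard_above_le_or_exists (by omega) hdim hint hcov S hS').resolve_right
      fun h => hS ⟨S, hS', h⟩
    have h := ncard_above_le (by omega) hdim hint hcov hb ⊥ (by simp)
    have hF : {P ∈ F | (⊥ : Submodule K V) ≤ P} = F := by simp
    rw [hF, finrank_bot, Nat.sub_zero, mul_comm] at h
    omega

end Family

/-! ### Subspaces of the extremal type -/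

section Extremal

variable {K V : Type*} [Field K] [AddCommGroup V] [Module K V] [FiniteDimensional K V]

omit [FiniteDimensional K V] in
/-- An injective map on `P` that respects membership in `W` preserves the type of `P`. -/
theorem IsOfType.range {W P : Submodule K V} {m k : ℕ} (hP : IsOfType W m k P) {φ : P →ₗ[K] V}
    (hφ : Function.Injective φ) (hW : ∀ p : P, φ p ∈ W ↔ (p : V) ∈ W) :
    IsOfType W m k (LinearMap.range φ) := by
  refine ⟨by rw [LinearMap.finrank_range_of_inj hφ, hP.1], ?_⟩
  have h1 : LinearMap.range φ ⊓ W = (W.comap P.subtype).map φ := by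
    ext v
    constructor
    · rintro ⟨⟨p, rfl⟩, hv⟩
      exact ⟨p, (hW p).1 hv, rfl⟩
    · rintro ⟨p, hp, rfl⟩
      exact ⟨⟨p, rfl⟩, (hW p).2 hp⟩
  have h2 : finrank K ((W.comap P.subtype).map φ) = finrank K (W.comap P.subtype) :=
    (Submodule.equivMapOfInjective φ hφ _).finrank_eq.symm
  have h3 : finrank K ((W.comap P.subtype).map P.subtype) = finrank K (W.comap P.subtype) :=
    (Submodule.equivMapOfInjective _ P.injective_subtype _).finrank_eq.symm
  rw [Submodule.map_comap_subtype, hP.2] at h3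
  rw [h1, h2, ← h3]

/-- Every `P` of type `(m, k)` lies in an `X` of the extremal type `(2 * m - 1, t)`, provided the
dimensions of `V` and `W` allow it. Moreover `P` has a complement `C` in `X` that is contained in
`W` (for `k ≥ 1`) or contains `X ⊓ W` (for `k = 0`). -/
theorem exists_extremal_compl {W P : Submodule K V} {n l m k : ℕ}
    (hV : finrank K V = n + l) (hW : finrank K W = l) (hm : 1 ≤ m) (hP : IsOfType W m k P)
    (hmV : 2 * m - 1 ≤ n + l) (hkl : 1 ≤ k → m + k - 1 ≤ l) :
    ∃ X C : Submodule K V, IsOfType W (2 * m - 1) (extremalParam m k n) X ∧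
      finrank K C = m - 1 ∧ P ⊓ C = ⊥ ∧ P ⊔ C = X ∧ (C ≤ W ∨ X ⊓ W ≤ C) := by
  have hPm := hP.1
  have hPk := hP.2
  rcases Nat.eq_zero_or_pos k with rfl | hk
  · have hPW : P ⊓ W = ⊥ := Submodule.finrank_eq_zero.1 hPk
    obtain ⟨U, hPU, hU⟩ := (disjoint_iff.2 hPW).exists_isCompl
    have hUdim := Submodule.finrank_add_eq_of_isCompl hU
    have hmU := Submodule.finrank_mono hPU
    have ht : extremalParam m 0 n = 2 * m - 1 - n := rfl
    obtain ⟨T, -, hTW, hT⟩ := exists_between_finrank (bot_le : ⊥ ≤ W)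
      (d := 2 * m - 1 - n) (by simp) (by omega)
    obtain ⟨U', hPU', hU'U, hU'⟩ := exists_between_finrank hPU
      (d := 2 * m - 1 - (2 * m - 1 - n)) (by omega) (by omega)
    have hU'W : U' ⊓ W = ⊥ := eq_bot_iff.2
      ((inf_le_inf_right W hU'U).trans_eq hU.inf_eq_bot)
    have hTU' : T ⊓ U' = ⊥ := eq_bot_iff.2
      ((le_inf inf_le_right (inf_le_left.trans hTW)).trans_eq hU'W)
    have hX := finrank_sup_of_inf_eq_bot hTU'
    have hXW : (T ⊔ U') ⊓ W = T := by
      rw [sup_inf_assoc_of_le U' hTW, hU'W, sup_bot_eq]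
    have hPT : P ⊓ T = ⊥ := eq_bot_iff.2 ((inf_le_inf_left P hTW).trans_eq hPW)
    obtain ⟨C, hTC, -, hPC, hPCX⟩ :=
      exists_relative_compl (hPU'.trans le_sup_right : P ≤ T ⊔ U') le_sup_left hPT
    have hC := finrank_sup_of_inf_eq_bot hPC
    rw [hPCX] at hC
    exact ⟨T ⊔ U', C, ⟨by omega, by rw [hXW, ht, hT]⟩, by omega, hPC, hPCX,
      Or.inr (hXW.trans_le hTC)⟩
  · have ht : extremalParam m k n = m + k - 1 := if_neg (by omega)
    obtain ⟨D, -, hDW, hPD, hPDW⟩ := exists_relative_compl (inf_le_right : P ⊓ W ≤ W)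
      (bot_le : ⊥ ≤ W) (inf_bot_eq _)
    have hD := finrank_sup_of_inf_eq_bot hPD
    rw [hPDW] at hD
    obtain ⟨C, -, hCD, hC⟩ := exists_between_finrank (bot_le : ⊥ ≤ D) (d := m - 1)
      (by simp) (by have := hkl hk; omega)
    have hCW := hCD.trans hDW
    have hPWC : P ⊓ W ⊓ C = ⊥ := eq_bot_iff.2 ((inf_le_inf_left _ hCD).trans_eq hPD)
    have hPC : P ⊓ C = ⊥ := by rwa [inf_assoc, inf_eq_right.2 hCW] at hPWC
    have hX := finrank_sup_of_inf_eq_bot hPC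
    have hXW : (P ⊔ C) ⊓ W = P ⊓ W ⊔ C := by
      rw [sup_comm, sup_inf_assoc_of_le P hCW, sup_comm]
    have hXWdim := finrank_sup_of_inf_eq_bot hPWC
    exact ⟨P ⊔ C, C, ⟨by omega, by rw [hXW, ht]; omega⟩, hC, hPC, rfl, Or.inl hCW⟩

variable [Finite K]

/-- The graphs of the linear maps from `P` to its complement `C` are of the same type as `P`. -/
theorem pow_le_ncard_subspacesOfType {W P X C : Submodule K V} {m k : ℕ}
    (hP : IsOfType W m k P) (hPC : P ⊓ C = ⊥) (hX : P ⊔ C = X) (hC : C ≤ W ∨ X ⊓ W ≤ C) :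
    Nat.card K ^ (m * finrank K C) ≤ (subspacesOfType W m k X).ncard := by
  let φ : (P →ₗ[K] C) → (P →ₗ[K] V) := fun f => P.subtype + C.subtype ∘ₗ f
  have hφ : ∀ f p, φ f p = (p : V) + (f p : V) := fun f p => rfl
  have hzero : ∀ v ∈ P, v ∈ C → v = 0 := fun v hv hv' => by
    have : v ∈ P ⊓ C := ⟨hv, hv'⟩
    rwa [hPC, Submodule.mem_bot] at this
  have hfst : ∀ (f g : P →ₗ[K] C) (p p' : P), φ f p = φ g p' → p = p' ∧ f p = g p' := by
    intro f g p p' h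
    rw [hφ, hφ] at h
    have h1 : (p : V) - p' = (g p' : V) - f p := by
      rw [sub_eq_sub_iff_add_eq_add, h, add_comm]
    have h2 := hzero ((p : V) - p') (P.sub_mem p.2 p'.2) (h1 ▸ C.sub_mem (g p').2 (f p).2)
    have h3 : (p : V) = p' := sub_eq_zero.1 h2
    exact ⟨Subtype.ext h3, Subtype.ext (by rw [h3] at h; exact add_left_cancel h)⟩
  have hinj : ∀ f, Function.Injective (φ f) := fun f p p' h => (hfst f f p p' h).1
  have hmem : ∀ f (p : P), φ f p ∈ W ↔ (p : V) ∈ W := by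
    intro f p
    rcases hC with hCW | hXC
    · exact W.add_mem_iff_left (hCW (f p).2)
    · constructor
      · intro h
        have hpX : φ f p ∈ X := hX ▸ Submodule.add_mem_sup p.2 (f p).2
        have hpC : (p : V) ∈ C := (C.add_mem_iff_left (f p).2).1 (hXC ⟨hpX, h⟩)
        rw [hzero _ p.2 hpC]
        exact W.zero_mem
      · intro h
        have hp : p = 0 := Subtype.ext
          (hzero _ p.2 (hXC ⟨hX ▸ Submodule.mem_sup_left p.2, h⟩))
        rw [hp, map_zero]
        exact W.zero_mem
  have hcard : Nat.card K ^ (m * finrank K C) = (Set.univ : Set (P →ₗ[K] C)).ncard := by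
    rw [Set.ncard_univ, Module.natCard_eq_pow_finrank (K := K) (V := P →ₗ[K] C),
      finrank_linearMap, hP.1]
  rw [hcard]
  refine Set.ncard_le_ncard_of_injOn (fun f => LinearMap.range (φ f)) ?_ ?_
    (finite_set_submodule _)
  · rintro f -
    refine ⟨?_, hP.range (hinj f) (hmem f)⟩
    rintro _ ⟨p, rfl⟩
    exact hX ▸ Submodule.add_mem_sup p.2 (f p).2
  · rintro f - g - h
    ext p
    have hp : φ f p ∈ LinearMap.range (φ g) := by
      rw [← show LinearMap.range (φ f) = LinearMap.range (φ g) from h]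
      exact ⟨p, rfl⟩
    obtain ⟨p', hp'⟩ := hp
    obtain ⟨rfl, h2⟩ := hfst g f p' p hp'
    rw [h2]

/-- For `k = 0`, fewer subspaces are left when `X` has a larger intersection with `W`: shrink
`X ⊓ W` to a subspace `Y` of dimension `t`. Missing `Y` is strictly weaker than missing `X ⊓ W`, and
`(X, Y)` is linearly equivalent to `(X', X' ⊓ W)`. -/
theorem ncard_subspacesOfType_zero_lt {W X X' : Submodule K V} {d m t : ℕ}
    (hX : finrank K X = d) (hX' : IsOfType W d t X')
    (ht : t < finrank K (X ⊓ W : Submodule K V)) (hm : 1 ≤ m) (hmt : m + t ≤ d) :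
    (subspacesOfType W m 0 X).ncard < (subspacesOfType W m 0 X').ncard := by
  obtain ⟨Y, -, hYX, hY⟩ := exists_between_finrank (bot_le : ⊥ ≤ X ⊓ W) (d := t) (by simp) ht.le
  have hcomap : ∀ P ≤ X, (P.comap X.subtype).map X.subtype = P := fun P hP => by
    rw [Submodule.map_comap_subtype, inf_eq_right.2 hP]
  have hcdim : ∀ Z P : Submodule K V,
      finrank K (P.comap Z.subtype) = finrank K (Z ⊓ P : Submodule K V) := fun Z P => by
    rw [← Submodule.map_comap_subtype]
    exact (Submodule.equivMapOfInjective _ Z.injective_subtype _).finrank_eq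
  obtain ⟨e, he⟩ := exists_linearEquiv_map_eq (hX.trans hX'.1.symm) (Y.comap X.subtype)
    (W.comap X'.subtype) (by
      rw [hcdim, hcdim, hX'.2, inf_eq_right.2 (hYX.trans inf_le_left), hY])
  let f : X →ₗ[K] V := X'.subtype ∘ₗ e.toLinearMap
  have hf : Function.Injective f := X'.injective_subtype.comp e.injective
  have hrank : ∀ P ≤ X, finrank K ((P.comap X.subtype).map f) = finrank K P := by
    intro P hP
    rw [← (Submodule.equivMapOfInjective f hf _).finrank_eq, hcdim, inf_eq_right.2 hP]
  have hlt : (subspacesOfType W m 0 X).ncard <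
      {P : Submodule K V | P ≤ X ∧ finrank K P = m ∧ P ⊓ Y = ⊥}.ncard := by
    refine Set.ncard_lt_ncard ((Set.ssubset_iff_of_subset ?_).2 ?_) (finite_set_submodule _)
    · rintro P ⟨hPX, hPm, hP0⟩
      refine ⟨hPX, hPm, eq_bot_iff.2 ?_⟩
      rw [← Submodule.finrank_eq_zero.1 hP0]
      exact inf_le_inf_left P (hYX.trans inf_le_right)
    · have hYlt : Y < X ⊓ W := lt_of_le_of_ne hYX (by rintro rfl; omega)
      obtain ⟨y, hy, hyY⟩ := SetLike.exists_of_lt hYlt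
      have hyX : K ∙ y ≤ X := (Submodule.span_singleton_le_iff_mem y X).2 hy.1
      have hy0 : y ≠ 0 := fun h => hyY (h ▸ Y.zero_mem)
      -- A subspace through `y` that misses `Y` is found inside a complement of `Y` through `y`.
      obtain ⟨C, hyC, hCX, hYC, hYCX⟩ := exists_relative_compl (hYX.trans inf_le_left) hyX
        (Submodule.disjoint_span_singleton_of_notMem hyY).eq_bot
      have hCdim := finrank_sup_of_inf_eq_bot hYC
      rw [hYCX] at hCdim
      obtain ⟨P, hyP, hPC, hPm⟩ := exists_between_finrank hyC (d := m)
        (by rwa [finrank_span_singleton hy0]) (by omega)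
      refine ⟨P, ⟨hPC.trans hCX, hPm, eq_bot_iff.2 ?_⟩, fun h => ?_⟩
      · rw [inf_comm, ← hYC]
        exact inf_le_inf_left Y hPC
      · have hmem : y ∈ P ⊓ W := ⟨(Submodule.span_singleton_le_iff_mem y P).1 hyP, hy.2⟩
        rw [Submodule.finrank_eq_zero.1 h.2.2] at hmem
        exact hy0 ((Submodule.mem_bot K).1 hmem)
  refine hlt.trans_le (Set.ncard_le_ncard_of_injOn (fun P => (P.comap X.subtype).map f) ?_ ?_
    (finite_set_submodule _))
  · rintro P ⟨hPX, hPm, hPY⟩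
    refine ⟨?_, by rw [hrank P hPX, hPm], Submodule.finrank_eq_zero.2 (eq_bot_iff.2 ?_)⟩
    · rintro _ ⟨x, -, rfl⟩
      exact (e x).2
    · rintro _ ⟨⟨x, hx, rfl⟩, hxW⟩
      have hxW' : e x ∈ W.comap X'.subtype := hxW
      rw [← he] at hxW'
      obtain ⟨x', hx', hxx'⟩ := hxW'
      obtain rfl : x' = x := e.injective hxx'
      have hx0 : (x' : V) ∈ P ⊓ Y := ⟨hx, hx'⟩
      rw [hPY, Submodule.mem_bot] at hx0
      obtain rfl : x' = 0 := Subtype.ext hx0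
      exact (Submodule.mem_bot K).2 (map_zero f)
  · rintro P ⟨hP, -⟩ Q ⟨hQ, -⟩ h
    have := Submodule.map_injective_of_injective hf h
    rw [← hcomap P hP, this, hcomap Q hQ]

end Extremal

end SingularLinear

theorem theorem3p1 {K V : Type*} [Field K] [Finite K] [AddCommGroup V] [Module K V]
    [FiniteDimensional K V] (n l m k : ℕ) (hn : 0 < n)
    (hV : Module.finrank K V = n + l)
    (W : Submodule K V) (hW : Module.finrank K W = l)
    (hq : m + 2 ≤ Nat.card K) (hm : 5 ≤ m + 2)
    (F : Set (Submodule K V)) (hF : ∀ P ∈ F, SingularLinear.IsOfType W m k P)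
    (hint : SingularLinear.IsIntersecting F)
    (hcov : SingularLinear.coveringNumber F = m) :
    F.ncard ≤ SingularLinear.numSubspaces W m k (2 * m - 1)
        (SingularLinear.extremalParam m k n) ∧
      (F.ncard = SingularLinear.numSubspaces W m k (2 * m - 1)
          (SingularLinear.extremalParam m k n) ↔
        ∃ X : Submodule K V,
          SingularLinear.IsOfType W (2 * m - 1) (SingularLinear.extremalParam m k n) X ∧
          F = SingularLinear.subspacesOfType W m k X) := by
  open SingularLinear in
  open Module in
  have hdim : ∀ P ∈ F, finrank K P = m := fun P hP => (hF P hP).1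
  -- `F` is nonempty, as the zero subspace does not cover it.
  obtain ⟨P₀, hP₀, -⟩ := exists_inf_eq_bot_of_lt_coveringNumber (F := F) (S := ⊥) (by
    rw [finrank_bot, hcov]
    omega)
  -- `V` has room for a subspace of dimension `2 * m - 1`: an `(m - 1)`-dimensional subspace misses
  -- some member.
  have hmV : 2 * m - 1 ≤ n + l := by
    obtain ⟨S, -, -, hS⟩ := exists_between_finrank (bot_le : ⊥ ≤ P₀) (d := m - 1) (by simp)
      (by rw [hdim P₀ hP₀]; omega)
    obtain ⟨A, hA, hSA⟩ := exists_inf_eq_bot_of_lt_coveringNumber (F := F) (S := S) (by omega)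
    have h1 := finrank_sup_of_inf_eq_bot hSA
    have h2 := Submodule.finrank_le (S ⊔ A)
    rw [hS, hdim A hA] at h1
    omega
  have hkY : ∀ Y : Submodule K V, (∀ P ∈ F, P ⊓ W ≤ Y) → 1 ≤ k → m + k - 1 ≤ finrank K Y := by
    intro Y hY hk
    have h := coveringNumber_add_le_finrank (Y := Y) hk ⟨P₀, hP₀⟩ fun P hP => by
      rw [← (hF P hP).2]
      exact Submodule.finrank_mono (le_inf inf_le_left (hY P hP))
    rwa [hcov] at h
  obtain ⟨X₀, C, hX₀, hC, hPC, hPCX, hCW⟩ := exists_extremal_compl hV hW (by omega) (hF P₀ hP₀) hmV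
    fun hk => (hkY W (fun _ _ => inf_le_right) hk).trans_eq hW
  have hN := numSubspaces_eq hX₀ m k
  have hpow := pow_le_ncard_subspacesOfType (hF P₀ hP₀) hPC hPCX hCW
  rw [hC, ← hN] at hpow
  have key : F.ncard < numSubspaces W m k (2 * m - 1) (extremalParam m k n) ∨
      ∃ X, IsOfType W (2 * m - 1) (extremalParam m k n) X ∧ F ⊆ subspacesOfType W m k X := by
    rcases ncard_lt_or_exists_forall_le (by omega) hq hdim hint hcov with hlt | ⟨X, hX, hFX⟩
    · exact Or.inl (hlt.trans_le hpow)
    have hsub : F ⊆ subspacesOfType W m k X := fun P hP => ⟨hFX P hP, hF P hP⟩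
    by_cases hXt : finrank K (X ⊓ W : Submodule K V) = extremalParam m k n
    · exact Or.inr ⟨X, ⟨hX, hXt⟩, hsub⟩
    rcases Nat.eq_zero_or_pos k with rfl | hk
    · left
      have ht : extremalParam m 0 n = 2 * m - 1 - n := rfl
      -- `h1`, `h2` give `2 * m - 1 - n ≤ dim (X ⊓ W)`, and `h3`, `h4` give `m ≤ n`.
      have h1 := Submodule.finrank_sup_add_finrank_inf_eq X W
      have h2 := Submodule.finrank_le (X ⊔ W)
      have h3 := finrank_sup_of_inf_eq_bot (Submodule.finrank_eq_zero.1 (hF P₀ hP₀).2)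
      have h4 := Submodule.finrank_le (P₀ ⊔ W)
      rw [hdim P₀ hP₀] at h3
      rw [hN]
      exact (Set.ncard_le_ncard hsub (finite_set_submodule _)).trans_lt
        (ncard_subspacesOfType_zero_lt hX hX₀ (by omega) (by omega) (by omega))
    · exfalso
      have ht : extremalParam m k n = m + k - 1 := if_neg (by omega)
      have h1 := hkY (X ⊓ W) (fun P hP => inf_le_inf_right W (hFX P hP)) hk
      -- `P₀` and `X ⊓ W` meet in dimension `k` inside `X`, which bounds `X ⊓ W` from above.
      have h2 := Submodule.finrank_sup_add_finrank_inf_eq P₀ (X ⊓ W)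
      have h3 := Submodule.finrank_mono (sup_le (hFX P₀ hP₀) inf_le_left : P₀ ⊔ X ⊓ W ≤ X)
      have h4 : P₀ ⊓ (X ⊓ W) = P₀ ⊓ W := by rw [← inf_assoc, inf_eq_left.2 (hFX P₀ hP₀)]
      rw [h4, (hF P₀ hP₀).2, hdim P₀ hP₀] at h2
      omega
  have hfin : ∀ G : Set (Submodule K V), G.Finite := finite_set_submodule
  rcases key with hlt | ⟨X, hX, hsub⟩
  · refine ⟨hlt.le, fun h => absurd h hlt.ne, ?_⟩
    rintro ⟨X, hX, rfl⟩
    exact (numSubspaces_eq hX m k).symm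
  · rw [numSubspaces_eq hX m k]
    refine ⟨Set.ncard_le_ncard hsub (hfin _), fun h => ⟨X, hX, ?_⟩, ?_⟩
    · exact Set.eq_of_subset_of_ncard_le hsub h.ge (hfin _)
    · rintro ⟨X', hX', rfl⟩
      rw [← numSubspaces_eq hX' m k, numSubspaces_eq hX m k]
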